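/- Let $\mathbb K$ be a field and let $R=\mathbb K[x_0,\dots,x_n]$ be the standard graded polynomial ring. Let $f_1,\dots,f_s\in R$ be forms of a common degree that are strongly generic, i.e. any at most $n+1$ of them (with distinct indices) form an $R$-regular sequence, and $\dim_{\mathbb K}(\mathbb K f_1+\cdots+\mathbb K f_s)=n+1$. Let $a,m_1,\dots,m_s$ be positive integers with $a\le m_1+\cdots+m_s$. For nonnegative integers $b,k_1,\dots,k_s$ put $$I_b(f_1^{k_1}\cdots f_s^{k_s})=\Big\langle f_1^{e_1}\cdots f_s^{e_s} : 0\le e_i\le k_i \text{ for each } i,\ \sum_i e_i=b\Big\rangle ,$$ and for $1\le i_1<\cdots<i_c\le s$ put $$\mu_a(i_1,\dots,i_c)=\max\Big\{0,\ a-\sum_{j\in\{1,\dots,s\}\setminus\{i_1,\dots,i_c\}}m_j\Big\}.$$ Then, with the convention that the $0$-th power of an ideal is $R$: (1) $$I_a(f_1^{m_1}\cdots f_s^{m_s})=\bigcap_{c=1}^{s}\ \bigcap_{1\le i_1<\cdots<i_c\le s}\langle f_{i_1},\dots,f_{i_c}\rangle^{\mu_a(i_1,\dots,i_c)}.$$ (2)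 $$I_{a+1}(f_1^{m_1}\cdots f_{s-1}^{m_{s-1}}f_s^{m_s+1}):f_s=I_a(f_1^{m_1}\cdots f_s^{m_s}),$$ and likewise with any other index $k\in\{1,\dots,s\}$ in the role of $s$. (3) The homogeneous ideal $I=I_a(f_1^{m_1}\cdots f_s^{m_s})$ has a Koszul stranded Betti table: if $n_1<\cdots<n_r$ are the degrees of the minimal homogeneous generators of $I$, then $n_1\ge 1$ and there is a positive integer $d$ such that, for all $i\ge 1$, the graded Betti number $\beta_{i,j}(R/I)$ (the number of basis elements of degree $j$ in the $i$-th module of the minimal graded free resolution of $R/I$) is nonzero only if $j\in\{n_h+d(i-1): h=1,\dots,r\}$. -/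

import Mathlib

open MvPolynomial

namespace FoldProduct

attribute [local instance] MvPolynomial.gradedAlgebra

variable {K : Type*} [Field K] {σ : Type*}

/-- The forms `f 0, …, f (s-1)` are `c`-generic: each of them is homogeneous, and any at most `c + 1`
of them (with pairwise distinct indices) form a regular sequence. For forms the order in which
they are listed is immaterial. -/
def IsGeneric {s : ℕ} (f : Fin s → MvPolynomial σ K) (c : ℕ) : Prop :=
  (∀ i, ∃ d : ℕ, (f i).IsHomogeneous d) ∧
    ∀ l : List (Fin s), l.Nodup → l.length ≤ c + 1 →
      RingTheory.Sequence.IsRegular (MvPolynomial σ K) (l.map f)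

/-- A family of forms in `K[x_0, …, x_n]` is strongly generic: the forms share a common degree,
they are generic (that is, `n`-generic), and they span a `K`-linear space of dimension `n + 1`. -/
def IsStronglyGeneric {n s : ℕ} (f : Fin s → MvPolynomial (Fin (n + 1)) K) : Prop :=
  (∃ d : ℕ, ∀ i, (f i).IsHomogeneous d) ∧ IsGeneric f n ∧
    Module.finrank K (Submodule.span K (Set.range f)) = n + 1

/-- The `a`-fold product ideal `I_a(f_1^{m_1} ⋯ f_s^{m_s})`. -/
def foldIdeal {R : Type*} [CommRing R] {s : ℕ} (f : Fin s → R) (m : Fin s → ℕ) (a : ℕ) :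
    Ideal R :=
  Ideal.span {g | ∃ e : Fin s → ℕ, (∀ i, e i ≤ m i) ∧ ∑ i, e i = a ∧ g = ∏ i, f i ^ e i}

/-- `μ_a(A) = max {0, a - ∑_{j ∉ A} m_j}`; subtraction of natural numbers is truncated at `0`. -/
def mu {s : ℕ} (m : Fin s → ℕ) (a : ℕ) (A : Finset (Fin s)) : ℕ :=
  a - ∑ j ∈ Aᶜ, m j

variable (σ K) in
/-- The graded maximal ideal, generated by the variables. -/
noncomputable def maxIdeal : Ideal (MvPolynomial σ K) :=
  Ideal.span (Set.range X)

/-- A graded free resolution of `R / I`, where `R` is the standard graded polynomial ring: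
`⋯ → F_2 → F_1 → F_0 → R / I → 0`, where `F_i` is the free module of finite rank on the basis `ι i`,
the basis vector `k` being placed in degree `deg i k`, i.e. `F_i = ⨁_k R(-deg i k)`. -/
structure GradedFreeResolution (I : Ideal (MvPolynomial σ K)) where
  ι : ℕ → Type
  finite_ι : ∀ i, Finite (ι i)
  deg : (i : ℕ) → ι i → ℕ
  /-- the differential `F_{i+1} → F_i` -/
  d : (i : ℕ) → (ι (i + 1) →₀ MvPolynomial σ K) →ₗ[MvPolynomial σ K] (ι i →₀ MvPolynomial σ K)
  /-- the augmentation `F_0 → R / I` -/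
  aug : (ι 0 →₀ MvPolynomial σ K) →ₗ[MvPolynomial σ K] (MvPolynomial σ K ⧸ I)
  /-- The differentials preserve degrees: the `k`-th coordinate `p` of the image of the basis
  vector `l` is homogeneous of degree `deg (i + 1) l - deg i k` (and is zero if that is negative). -/
  d_homogeneous : ∀ i (l : ι (i + 1)) (k : ι i) (u : σ →₀ ℕ),
    coeff u (d i (Finsupp.single l 1) k) ≠ 0 → u.degree + deg i k = deg (i + 1) l
  /-- The augmentation preserves degrees. -/
  aug_homogeneous : ∀ k : ι 0, ∃ p : MvPolynomial σ K,
    p.IsHomogeneous (deg 0 k) ∧ aug (Finsupp.single k 1) = Ideal.Quotient.mk I p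
  aug_surjective : Function.Surjective aug
  exact_zero : Function.Exact (d 0) aug
  exact_succ : ∀ i, Function.Exact (d (i + 1)) (d i)

/-- A graded free resolution is minimal if `F_{i+1}` is mapped into `𝔪 F_i` for all `i`. -/
def GradedFreeResolution.IsMinimal {I : Ideal (MvPolynomial σ K)}
    (F : GradedFreeResolution I) : Prop :=
  ∀ i (v : F.ι (i + 1) →₀ MvPolynomial σ K) (k : F.ι i), F.d i v k ∈ maxIdeal K σ

/-- `β i j = β_{i,j}(R / I)` for all `i, j`: in the minimal graded free resolution of `R / I`
(unique up to isomorphism) `F_i` has exactly `β i j` basis vectors of degree `j`. -/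
def IsGradedBettiTable (I : Ideal (MvPolynomial σ K)) (β : ℕ → ℕ → ℕ) : Prop :=
  ∃ F : GradedFreeResolution I, F.IsMinimal ∧
    ∀ i j, β i j = Nat.card {k : F.ι i // F.deg i k = j}

/-- The degrees in which the ideal `I` has a minimal homogeneous generator: the degrees of the
forms in `I` that do not lie in `𝔪 I`. -/
def generatorDegrees (I : Ideal (MvPolynomial σ K)) : Set ℕ :=
  {n | ∃ g ∈ I, g.IsHomogeneous n ∧ g ∉ maxIdeal K σ * I}

/-- The homogeneous ideal `I`, generated in degrees `1 ≤ n_1 < ⋯ < n_r`, has a Koszul stranded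
Betti table: there is a positive integer `d` such that, for `i ≥ 1`, `β_{i,j}(R / I) ≠ 0` only if
`j = n_h + d (i - 1)` for some `h`. -/
def HasKoszulStrandedBettiTable (I : Ideal (MvPolynomial σ K)) : Prop :=
  I.IsHomogeneous (homogeneousSubmodule σ K) ∧
    (∀ n ∈ generatorDegrees I, 1 ≤ n) ∧
    ∃ β : ℕ → ℕ → ℕ, IsGradedBettiTable I β ∧
      ∃ d : ℕ, 0 < d ∧ ∀ i j, 1 ≤ i → β i j ≠ 0 →
        ∃ n ∈ generatorDegrees I, j = n + d * (i - 1)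

end FoldProduct

/-! Genericity enters only through two properties. `RegularUpTo f r` says that each form is a
nonzerodivisor modulo fewer than `r` others. `SpannedBy f r` says that any `r` of the forms generate
the ideal of all of them. Here `r = n + 1`.

Everything is proved modulo an auxiliary set `T` of forms, by induction on `∑ m i`. Choose `j ∉ T`
with `m j > 0`. Killing `f j` moves `j` into `T` and replaces `m j` by `0`; dividing by `f j`
replaces `(m, a + 1)` by `(m - e_j, a)`. Both lower the sum.

For the intersection formula the point is that the powers behave well under division: modulo `T`,
cancelling `f j` keeps the exponent on `A` if `j ∉ A` and lowers it by one if `j ∈ A`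
(`RegularUpTo.cancel_of_notMem`, `RegularUpTo.cancel_of_mem`). This matches the change of `mu`. An
element of the intersection is thus a fold element plus a multiple `f j * u`, with `u` in the
smaller intersection (`mem_foldIdeal_sup_of_forall`). The colon formula is the same division with `T
= ∅`.

For the Betti table, write `I(m, a)` for the image of the fold ideal in `R / (T)`. The colon formula
modulo `T` gives an exact sequence `0 → I(m - e_j, a)(-d) → I(m, a + 1) → I' → 0`, where `I'` is the
fold ideal with `m j = 0` modulo `T ∪ {j}`. Both ends are generated in degree `d * (a + 1)` with all
further steps of degree `d`, so the horseshoe construction (`HasRelativeLinearResolution.trans`)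
gives the same for the middle. For `a = 0` one resolves `R / (T)`, whose steps have degree `d` as in
the Koszul complex. Hence there is a single strand, and it is minimal because all entries have
positive degree. -/

namespace FoldProduct

attribute [local instance] MvPolynomial.gradedAlgebra

/-! ### Cancelling one form modulo powers of ideals generated by other forms. -/

section Ring

variable {R : Type*} [CommRing R] {s : ℕ}

/-- The ideal generated by the members of the family `f` with index in `A`. -/
abbrev indexIdeal (f : Fin s → R) (A : Finset (Fin s)) : Ideal R :=
  Ideal.span (f '' (A : Set (Fin s)))

/-- Every member of the family is a nonzerodivisor modulo any fewer than `r` other members. -/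
def RegularUpTo (f : Fin s → R) (r : ℕ) : Prop :=
  ∀ (A : Finset (Fin s)) (j : Fin s), A.card < r → j ∉ A →
    ∀ h, f j * h ∈ indexIdeal f A → h ∈ indexIdeal f A

/-- Any `r` members of the family generate the ideal of all of them. -/
def SpannedBy (f : Fin s → R) (r : ℕ) : Prop :=
  ∀ A : Finset (Fin s), r ≤ A.card → ∀ i, f i ∈ indexIdeal f A

variable {f : Fin s → R} {r : ℕ}

lemma mem_indexIdeal {A : Finset (Fin s)} {i : Fin s} (hi : i ∈ A) : f i ∈ indexIdeal f A :=
  Ideal.subset_span ⟨i, hi, rfl⟩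

lemma indexIdeal_le_iff {A : Finset (Fin s)} {I : Ideal R} :
    indexIdeal f A ≤ I ↔ ∀ i ∈ A, f i ∈ I := by
  rw [Ideal.span_le]
  constructor
  · exact fun h i hi => h ⟨i, hi, rfl⟩
  · rintro h _ ⟨i, hi, rfl⟩
    exact h i hi

lemma indexIdeal_mono {A B : Finset (Fin s)} (h : A ⊆ B) : indexIdeal f A ≤ indexIdeal f B :=
  indexIdeal_le_iff.2 fun _ hi => mem_indexIdeal (h hi)

lemma indexIdeal_insert (A : Finset (Fin s)) (b : Fin s) :
    indexIdeal f (insert b A) = Ideal.span {f b} ⊔ indexIdeal f A := by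
  rw [indexIdeal, Finset.coe_insert, Set.image_insert_eq, Ideal.span_insert]

lemma indexIdeal_union (A B : Finset (Fin s)) :
    indexIdeal f (A ∪ B) = indexIdeal f A ⊔ indexIdeal f B := by
  rw [indexIdeal, Finset.coe_union, Set.image_union, Ideal.span_union]

lemma mem_sup_of_le_of_le {A A' B B' : Ideal R} (hA : A ≤ A') (hB : B ≤ B') {g : R}
    (hg : g ∈ A ⊔ B) : g ∈ A' ⊔ B' :=
  sup_le_sup hA hB hg

lemma mem_of_mem_sup_of_le {A B C : Ideal R} (hA : A ≤ C) (hB : B ≤ C) {g : R}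
    (hg : g ∈ A ⊔ B) : g ∈ C :=
  sup_le hA hB hg

lemma sup_pow_le_sup (A B : Ideal R) (k : ℕ) : (A ⊔ B) ^ k ≤ A ⊔ B ^ k := by
  induction k with
  | zero => simp
  | succ k ih =>
    rw [pow_succ, pow_succ]
    refine (Ideal.mul_mono_left ih).trans ?_
    rw [Ideal.sup_mul, Ideal.mul_sup (B ^ k)]
    exact sup_le (le_sup_of_le_left Ideal.mul_le_left)
      (sup_le (le_sup_of_le_left Ideal.mul_le_right) le_sup_right)

lemma sup_pow_succ_le (A B : Ideal R) (k : ℕ) :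
    (A ⊔ B) ^ (k + 1) ≤ A * (A ⊔ B) ^ k ⊔ B ^ (k + 1) := by
  induction k with
  | zero => simp
  | succ k ih =>
    rw [pow_succ (A ⊔ B) (k + 1), Ideal.mul_sup]
    refine sup_le (le_sup_of_le_left (mul_comm _ _).le) ?_
    refine (Ideal.mul_mono_left ih).trans ?_
    rw [Ideal.sup_mul, pow_succ B (k + 1), mul_assoc, pow_succ (A ⊔ B) k]
    exact sup_le_sup (Ideal.mul_mono_right (Ideal.mul_mono_right le_sup_right)) le_rfl

/-- Cancelling `f b` lowers the exponent by one, if `f b` may be cancelled modulo the powers of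
the ideal of the other generators. -/
lemma cancel_mem_of_erase {T A : Finset (Fin s)} {b : Fin s} {k : ℕ}
    (H : ∀ g, f b * g ∈ indexIdeal f T ⊔ indexIdeal f A ^ (k + 1) →
      g ∈ indexIdeal f T ⊔ indexIdeal f A ^ (k + 1))
    {g : R} (hg : f b * g ∈ indexIdeal f T ⊔ indexIdeal f (insert b A) ^ (k + 1)) :
    g ∈ indexIdeal f T ⊔ indexIdeal f (insert b A) ^ k := by
  obtain ⟨t, ht, w, hw, e⟩ := Submodule.mem_sup.1 hg
  rw [indexIdeal_insert] at hw
  obtain ⟨y, hy, w', hw', rfl⟩ := Submodule.mem_sup.1 (sup_pow_succ_le _ _ _ hw)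
  obtain ⟨u, hu, rfl⟩ := Ideal.mem_span_singleton_mul.1 hy
  rw [← indexIdeal_insert] at hu
  -- Splitting off the multiples of `f b` leaves only `A ^ (k + 1)`, modulo which `f b` cancels by
  -- `H`; the part `u` already lies in the `k`-th power.
  have h1 : g - u ∈ indexIdeal f T ⊔ indexIdeal f A ^ (k + 1) := by
    refine H _ ?_
    have : f b * (g - u) = t + w' := by linear_combination -e
    rw [this]
    exact Submodule.add_mem_sup ht hw'
  have h2 : indexIdeal f A ^ (k + 1) ≤ indexIdeal f (insert b A) ^ k :=
    (Ideal.pow_le_pow_right k.le_succ).trans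
      (Ideal.pow_right_mono (indexIdeal_mono (Finset.subset_insert _ _)) _)
  have := add_mem (mem_sup_of_le_of_le le_rfl h2 h1) (Ideal.mem_sup_right hu)
  simpa using this

lemma sup_pow_insert_le_of_mem {T A : Finset (Fin s)} {b : Fin s} (hb : b ∈ T) (k : ℕ) :
    indexIdeal f T ⊔ indexIdeal f (insert b A) ^ k ≤ indexIdeal f T ⊔ indexIdeal f A ^ k := by
  refine sup_le le_sup_left ?_
  rw [indexIdeal_insert]
  refine (sup_pow_le_sup _ _ _).trans (sup_le_sup ?_ le_rfl)
  exact (Ideal.span_singleton_le_iff_mem _).2 (mem_indexIdeal hb)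

/-- Double induction, on `A` for all `T` and then on `k`. A generator `b` of `A` is moved into `T`,
giving `g = u * f b + v` with `v` harmless. Cancelling `f b` from `f b * (f j * u)` lowers the
exponent by one, the inner induction cancels `f j`, and multiplying back by `f b` restores the
exponent. -/
theorem RegularUpTo.cancel_of_notMem (hf : RegularUpTo f r) (A : Finset (Fin s)) :
    ∀ (T : Finset (Fin s)) (j : Fin s) (k : ℕ) (g : R), j ∉ A ∪ T → (A ∪ T).card < r →
      f j * g ∈ indexIdeal f T ⊔ indexIdeal f A ^ k →
      g ∈ indexIdeal f T ⊔ indexIdeal f A ^ k := by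
  induction A using Finset.induction_on with
  | empty =>
    intro T j k g hj hr hg
    rcases k with _ | k
    · simp
    · have e : indexIdeal f (∅ : Finset (Fin s)) ^ (k + 1) = ⊥ := by
        simp [indexIdeal]
      rw [e, sup_bot_eq] at hg ⊢
      rw [Finset.empty_union] at hj hr
      exact hf T j hr hj g hg
  | insert b A hbA ih =>
    intro T j k
    by_cases hbT : b ∈ T
    · intro g hj hr hg
      have hu : insert b A ∪ T = A ∪ T := by
        rw [Finset.insert_union, Finset.insert_eq_of_mem (Finset.mem_union_right _ hbT)]
      rw [hu] at hj hr
      have := ih T j k g hj hr (sup_pow_insert_le_of_mem hbT k hg)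
      exact mem_sup_of_le_of_le le_rfl
        (Ideal.pow_right_mono (indexIdeal_mono (Finset.subset_insert _ _)) _) this
    · induction k with
      | zero => simp
      | succ k ihk =>
        intro g hj hr hg
        have hbu : b ∉ A ∪ T := by simp [hbA, hbT]
        have hlt : (A ∪ T).card < r :=
          (Finset.card_le_card (Finset.union_subset_union_left (Finset.subset_insert b A))).trans_lt
            hr
        have hle : indexIdeal f T ⊔ indexIdeal f (insert b A) ^ (k + 1) ≤
            indexIdeal f (insert b T) ⊔ indexIdeal f A ^ (k + 1) := by
          refine sup_le (le_sup_of_le_left (indexIdeal_mono (Finset.subset_insert _ _))) ?_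
          rw [indexIdeal_insert A, indexIdeal_insert T]
          refine (sup_pow_le_sup _ _ _).trans (sup_le_sup le_sup_left le_rfl)
        have hu : A ∪ insert b T = insert b A ∪ T := by
          rw [Finset.union_insert, Finset.insert_union]
        have h1 := ih (insert b T) j (k + 1) g (hu ▸ hj) (hu ▸ hr) (hle hg)
        rw [indexIdeal_insert, sup_assoc] at h1
        obtain ⟨y, hy, v, hv, rfl⟩ := Submodule.mem_sup.1 h1
        obtain ⟨u, rfl⟩ := Ideal.mem_span_singleton'.1 hy
        have hv' : v ∈ indexIdeal f T ⊔ indexIdeal f (insert b A) ^ (k + 1) :=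
          mem_sup_of_le_of_le le_rfl
            (Ideal.pow_right_mono (indexIdeal_mono (Finset.subset_insert _ _)) _) hv
        refine add_mem ?_ hv'
        have h2 : f b * (f j * u) ∈ indexIdeal f T ⊔ indexIdeal f (insert b A) ^ (k + 1) := by
          have := sub_mem hg (Ideal.mul_mem_left _ (f j) hv')
          convert this using 1
          ring
        have h3 := cancel_mem_of_erase (fun g => ih T b (k + 1) g hbu hlt) h2
        have h4 := ihk u hj hr h3
        obtain ⟨t, ht, w, hw, rfl⟩ := Submodule.mem_sup.1 h4
        rw [add_mul]
        refine Submodule.add_mem_sup (Ideal.mul_mem_right _ _ ht) ?_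
        rw [pow_succ]
        exact Ideal.mul_mem_mul hw (mem_indexIdeal (Finset.mem_insert_self _ _))

/-- Apply `cancel_mem_of_erase` with `b = j`: modulo powers of the other generators `f j` is
regular. The bound is `≤ r` since `j` itself is removed before regularity is used. -/
theorem RegularUpTo.cancel_of_mem_of_card_le (hf : RegularUpTo f r) {A T : Finset (Fin s)}
    {j : Fin s} (hj : j ∈ A) (hjT : j ∉ T) (hr : (A ∪ T).card ≤ r) {k : ℕ} {g : R}
    (hg : f j * g ∈ indexIdeal f T ⊔ indexIdeal f A ^ (k + 1)) :
    g ∈ indexIdeal f T ⊔ indexIdeal f A ^ k := by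
  rw [← Finset.insert_erase hj] at hg ⊢
  refine cancel_mem_of_erase (fun g => ?_) hg
  refine hf.cancel_of_notMem (A.erase j) T j (k + 1) g (by simp [hjT]) ?_
  refine (Finset.card_lt_card ?_).trans_le hr
  refine (Finset.ssubset_iff_of_subset
    (Finset.union_subset_union_left (Finset.erase_subset _ _))).2 ⟨j, ?_, ?_⟩
  · simp [hj]
  · simp [hjT]

/-- Once `A ∪ T` has `r` elements, `A` generates all the forms modulo `T`, so it may replace any
other set. -/
lemma SpannedBy.sup_pow_le (hs : SpannedBy f r) {A B T : Finset (Fin s)}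
    (hr : r ≤ (A ∪ T).card) (k : ℕ) :
    indexIdeal f T ⊔ indexIdeal f B ^ k ≤ indexIdeal f T ⊔ indexIdeal f A ^ k := by
  refine sup_le le_sup_left ?_
  have : indexIdeal f B ≤ indexIdeal f T ⊔ indexIdeal f A := by
    rw [sup_comm, ← indexIdeal_union]
    exact indexIdeal_le_iff.2 fun i _ => hs _ hr i
  exact (Ideal.pow_right_mono this k).trans (sup_pow_le_sup _ _ _)

theorem RegularUpTo.cancel_of_mem (hf : RegularUpTo f r) (hs : SpannedBy f r)
    {A T : Finset (Fin s)} {j : Fin s} (hj : j ∈ A) (hjT : j ∉ T) (hT : T.card < r) {k : ℕ} {g : R}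
    (hg : f j * g ∈ indexIdeal f T ⊔ indexIdeal f A ^ (k + 1)) :
    g ∈ indexIdeal f T ⊔ indexIdeal f A ^ k := by
  rcases le_total (A ∪ T).card r with hr | hr
  · exact hf.cancel_of_mem_of_card_le hj hjT hr hg
  -- When `A ∪ T` is too large for regularity, shrink it to a set `B` of exactly `r` elements
  -- containing `j` and `T`. Modulo `T`, both `A` and `B \ T` generate every form.
  · have hsub : insert j T ⊆ A ∪ T :=
      Finset.insert_subset (Finset.mem_union_left _ hj) Finset.subset_union_right
    have hcard : (insert j T).card ≤ r := by
      rw [Finset.card_insert_of_notMem hjT]; omega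
    obtain ⟨B, hB1, hB2, hB3⟩ := Finset.exists_subsuperset_card_eq hsub hcard hr
    have hTB : T ⊆ B := (Finset.subset_insert _ _).trans hB1
    have hu : B \ T ∪ T = B := Finset.sdiff_union_of_subset hTB
    have hj' : j ∈ B \ T := Finset.mem_sdiff.2 ⟨hB1 (Finset.mem_insert_self _ _), hjT⟩
    have h1 : f j * g ∈ indexIdeal f T ⊔ indexIdeal f (B \ T) ^ (k + 1) :=
      hs.sup_pow_le (by rw [hu, hB3]) _ hg
    have h2 := hf.cancel_of_mem_of_card_le hj' hjT (by rw [hu, hB3]) h1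
    exact hs.sup_pow_le hr _ h2

/-! ### Fold ideals as intersections of powers, and their colon ideals. -/

section FoldIdeal

variable {m m' : Fin s → ℕ} {a : ℕ}

lemma foldIdeal_zero (f : Fin s → R) (m : Fin s → ℕ) : foldIdeal f m 0 = ⊤ := by
  rw [Ideal.eq_top_iff_one]
  exact Ideal.subset_span ⟨0, by simp, by simp, by simp⟩

lemma foldIdeal_mono (h : ∀ i, m i ≤ m' i) : foldIdeal f m a ≤ foldIdeal f m' a := by
  refine Ideal.span_mono ?_
  rintro g ⟨e, he, hs, rfl⟩
  exact ⟨e, fun i => (he i).trans (h i), hs, rfl⟩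

lemma mul_mem_foldIdeal {j : Fin s} (hj : 0 < m j) {g : R}
    (hg : g ∈ foldIdeal f (Function.update m j (m j - 1)) a) :
    f j * g ∈ foldIdeal f m (a + 1) := by
  induction hg using Submodule.span_induction with
  | mem g hg =>
    obtain ⟨e, he, hs, rfl⟩ := hg
    refine Ideal.subset_span ⟨e + Pi.single j 1, fun i => ?_, ?_, ?_⟩
    · have := he i
      rcases eq_or_ne i j with rfl | hij
      · simp at this ⊢; omega
      · simpa [hij] using this
    · simp [Finset.sum_add_distrib, hs]
    · simp only [Pi.add_apply, pow_add, Finset.prod_mul_distrib]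
      rw [mul_comm]
      congr 1
      rw [Finset.prod_eq_single j]
      · simp
      · intro i _ hi
        simp [hi]
      · simp
  | zero => simp
  | add x y _ _ hx hy => rw [mul_add]; exact add_mem hx hy
  | smul c x _ hx =>
    rw [smul_eq_mul, mul_left_comm]
    exact Ideal.mul_mem_left _ _ hx

lemma foldIdeal_le_sup (f : Fin s → R) (m : Fin s → ℕ) (a : ℕ) (j : Fin s) :
    foldIdeal f m a ≤ foldIdeal f (Function.update m j 0) a ⊔ Ideal.span {f j} := by
  refine Ideal.span_le.2 ?_
  rintro g ⟨e, he, hs, rfl⟩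
  by_cases hj : e j = 0
  · refine Ideal.mem_sup_left (Ideal.subset_span ⟨e, fun i => ?_, hs, rfl⟩)
    rcases eq_or_ne i j with rfl | hij
    · simp [hj]
    · simpa [hij] using he i
  · refine Ideal.mem_sup_right (Ideal.mem_span_singleton.2 ?_)
    exact (dvd_pow_self _ hj).trans (Finset.dvd_prod_of_mem _ (Finset.mem_univ j))

/-- At most `∑ j ∈ Aᶜ, m j` of the `a` factors of a generator can come from outside `A`. -/
lemma foldIdeal_le_pow (f : Fin s → R) (m : Fin s → ℕ) (a : ℕ) (A : Finset (Fin s)) :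
    foldIdeal f m a ≤ indexIdeal f A ^ mu m a A := by
  refine Ideal.span_le.2 ?_
  rintro g ⟨e, he, hs, rfl⟩
  have h1 : ∑ i ∈ A, e i + ∑ i ∈ Aᶜ, e i = a := by rw [Finset.sum_add_sum_compl, hs]
  have h2 : ∑ i ∈ Aᶜ, e i ≤ ∑ i ∈ Aᶜ, m i := Finset.sum_le_sum fun i _ => he i
  have h3 : mu m a A ≤ ∑ i ∈ A, e i := by unfold mu; omega
  refine Ideal.pow_le_pow_right h3 ?_
  rw [← Finset.prod_mul_prod_compl A]
  refine Ideal.mul_mem_right _ _ ?_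
  rw [← Finset.prod_pow_eq_pow_sum]
  exact Ideal.prod_mem_prod fun i hi => Ideal.pow_mem_pow (mem_indexIdeal hi) _

lemma foldIdeal_le_indexIdeal {A : Finset (Fin s)} (h : ∀ j ∉ A, m j = 0) (ha : 0 < a) :
    foldIdeal f m a ≤ indexIdeal f A := by
  refine (foldIdeal_le_pow f m a A).trans (Ideal.pow_le_self ?_)
  have : ∑ j ∈ Aᶜ, m j = 0 := Finset.sum_eq_zero fun j hj => h j (by simpa using hj)
  unfold mu
  omega

lemma sum_update_pred {j : Fin s} (hj : 0 < m j) {A : Finset (Fin s)} (hjA : j ∈ A) :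
    ∑ i ∈ A, Function.update m j (m j - 1) i + 1 = ∑ i ∈ A, m i := by
  rw [Finset.sum_update_of_mem hjA, ← Finset.sum_sdiff (Finset.singleton_subset_iff.2 hjA)]
  simp only [Finset.sum_singleton]
  omega

lemma sum_update_zero {j : Fin s} {A : Finset (Fin s)} (hjA : j ∈ A) :
    ∑ i ∈ A, Function.update m j 0 i + m j = ∑ i ∈ A, m i := by
  rw [Finset.sum_update_of_mem hjA, ← Finset.sum_sdiff (Finset.singleton_subset_iff.2 hjA)]
  simp

lemma sum_update_of_notMem {j : Fin s} {A : Finset (Fin s)} (hjA : j ∉ A) (b : ℕ) :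
    ∑ i ∈ A, Function.update m j b i = ∑ i ∈ A, m i :=
  Finset.sum_congr rfl fun _ hi => Function.update_of_ne (ne_of_mem_of_not_mem hi hjA) _ _

/-- Passing from `(m, a + 1)` to `(m - e_j, a)` in the intersection of powers is division by
`f j`. -/
theorem mem_sup_pow_mu_of_mul_mem (hf : RegularUpTo f r) (hs : SpannedBy f r)
    {T : Finset (Fin s)} {j : Fin s} (hj : 0 < m j) (hjT : j ∉ T) (hT : T.card < r) {g : R}
    (hg : ∀ A, f j * g ∈ indexIdeal f T ⊔ indexIdeal f A ^ mu m (a + 1) A) (A : Finset (Fin s)) :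
    g ∈ indexIdeal f T ⊔
      indexIdeal f A ^ mu (Function.update m j (m j - 1)) a A := by
  by_cases hjA : j ∈ A
  · have hmu : mu (Function.update m j (m j - 1)) a A = mu m (a + 1) A - 1 := by
      unfold mu
      rw [sum_update_of_notMem (by simpa using hjA)]
      omega
    rcases hk : mu m (a + 1) A with _ | k
    · simp [hmu, hk]
    · rw [hmu, hk]
      have := hg A
      rw [hk] at this
      exact hf.cancel_of_mem hs hjA hjT hT this
  · have hsum := sum_update_pred hj (A := Aᶜ) (by simpa using hjA)
    have hmu : mu (Function.update m j (m j - 1)) a A = mu m (a + 1) A := by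
      unfold mu
      omega
    rw [hmu]
    rcases lt_or_ge (A ∪ T).card r with hr | hr
    · exact hf.cancel_of_notMem A T j _ g (by simp [hjA, hjT]) hr (hg A)
    -- Here `A` generates every form modulo `T`, so the condition for all indices suffices: it
    -- yields exponent `a`, and `mu m (a + 1) A ≤ a` because `j ∉ A` and `m j ≥ 1`.
    · have h1 := hg Finset.univ
      have h2 : mu m (a + 1) Finset.univ = a + 1 := by simp [mu]
      rw [h2] at h1
      have h3 := hf.cancel_of_mem hs (Finset.mem_univ j) hjT hT h1
      have h4 : mu m (a + 1) A ≤ a := by unfold mu; omega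
      exact hs.sup_pow_le hr _ (mem_sup_of_le_of_le le_rfl (Ideal.pow_le_pow_right h4) h3)

/-- The set `T` is needed because the induction also passes to the quotient by `f j`. Allowing `A =
∅` makes a bound `a ≤ ∑ i, m i` unnecessary: for larger `a` that condition forces `g` into the ideal
of `T`. -/
theorem mem_foldIdeal_sup_of_forall (hf : RegularUpTo f r) (hs : SpannedBy f r) (N : ℕ) :
    ∀ (T : Finset (Fin s)) (m : Fin s → ℕ) (a : ℕ), ∑ i, m i ≤ N →
      ∀ g, (∀ A, g ∈ indexIdeal f T ⊔ indexIdeal f A ^ mu m a A) →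
        g ∈ foldIdeal f m a ⊔ indexIdeal f T := by
  induction N with
  | zero =>
    intro T m a hN g hg
    rcases a with _ | a
    · simp [foldIdeal_zero]
    · have h0 : mu m (a + 1) ∅ = a + 1 := by
        unfold mu; simp only [Finset.compl_empty]; omega
      have := hg ∅
      rw [h0] at this
      exact Ideal.mem_sup_right (by simpa [indexIdeal] using this)
  | succ N ih =>
    intro T m a hN g hg
    rcases a with _ | a
    · simp [foldIdeal_zero]
    by_cases hTr : r ≤ T.card
    · have h1 := hg Finset.univ
      have h2 : mu m (a + 1) Finset.univ ≠ 0 := by simp [mu]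
      refine Ideal.mem_sup_right (mem_of_mem_sup_of_le le_rfl ((Ideal.pow_le_self h2).trans ?_) h1)
      exact indexIdeal_le_iff.2 fun i _ => hs T hTr i
    by_cases hex : ∃ j, j ∉ T ∧ 0 < m j
    · obtain ⟨j, hjT, hj⟩ := hex
      have hN0 := sum_update_zero (m := m) (Finset.mem_univ j)
      have hN1 := sum_update_pred hj (Finset.mem_univ j)
      -- Modulo `f j` the sets `A` and `insert j A` give the same powers, and the hypothesis for
      -- `insert j A` has exactly the exponent that `A` requires once `m j` is replaced by `0`.
      have h1 : g ∈ foldIdeal f (Function.update m j 0) (a + 1) ⊔ indexIdeal f (insert j T) := by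
        refine ih _ _ _ (by omega) g fun A => ?_
        have h2 := hg (insert j A)
        have hmu : mu m (a + 1) (insert j A) = mu (Function.update m j 0) (a + 1) A := by
          unfold mu
          congr 1
          by_cases hjA : j ∈ A
          · rw [Finset.insert_eq_of_mem hjA, sum_update_of_notMem (by simpa using hjA)]
          · have h3 := sum_update_zero (m := m) (A := Aᶜ) (by simpa using hjA)
            have h4 := Finset.sum_erase_add (s := Aᶜ) m (a := j) (by simpa using hjA)
            rw [Finset.compl_insert]
            omega
        rw [hmu] at h2
        refine mem_of_mem_sup_of_le
          (le_sup_of_le_left (indexIdeal_mono (Finset.subset_insert _ _))) ?_ h2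
        rw [indexIdeal_insert A, indexIdeal_insert T]
        exact (sup_pow_le_sup _ _ _).trans (sup_le_sup le_sup_left le_rfl)
      rw [indexIdeal_insert, sup_left_comm] at h1
      obtain ⟨y, hy, h', hh', rfl⟩ := Submodule.mem_sup.1 h1
      obtain ⟨u, rfl⟩ := Ideal.mem_span_singleton.1 hy
      have hle : foldIdeal f (Function.update m j 0) (a + 1) ≤ foldIdeal f m (a + 1) :=
        foldIdeal_mono fun i => by
          rcases eq_or_ne i j with rfl | hij <;> simp [*]
      have hh := mem_sup_of_le_of_le hle (le_refl (indexIdeal f T)) hh'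
      refine add_mem ?_ hh
      -- Subtracting the fold element `h'`, which satisfies every power condition, leaves a multiple
      -- of `f j` to which division applies.
      have h5 : ∀ A, f j * u ∈ indexIdeal f T ⊔ indexIdeal f A ^ mu m (a + 1) A := fun A => by
        have h6 : h' ∈ indexIdeal f T ⊔ indexIdeal f A ^ mu m (a + 1) A := by
          rw [sup_comm]
          exact mem_sup_of_le_of_le (foldIdeal_le_pow f m _ A) le_rfl hh
        simpa using sub_mem (hg A) h6
      have h7 := ih T (Function.update m j (m j - 1)) a (by omega) u
        (mem_sup_pow_mu_of_mul_mem hf hs hj hjT (by omega) h5)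
      obtain ⟨x, hx, t, ht, rfl⟩ := Submodule.mem_sup.1 h7
      rw [mul_add]
      exact Submodule.add_mem_sup (mul_mem_foldIdeal hj hx) (Ideal.mul_mem_left _ _ ht)
    · push Not at hex
      have h0 : mu m (a + 1) T ≠ 0 := by
        have : ∑ j ∈ Tᶜ, m j = 0 :=
          Finset.sum_eq_zero fun j hj => by simpa using hex j (by simpa using hj)
        unfold mu; omega
      exact Ideal.mem_sup_right (mem_of_mem_sup_of_le le_rfl (Ideal.pow_le_self h0) (hg T))

theorem mem_foldIdeal_sup_iff (hf : RegularUpTo f r) (hs : SpannedBy f r)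
    {T : Finset (Fin s)} {g : R} :
    g ∈ foldIdeal f m a ⊔ indexIdeal f T ↔
      ∀ A, g ∈ indexIdeal f T ⊔ indexIdeal f A ^ mu m a A := by
  refine ⟨fun h A => ?_, mem_foldIdeal_sup_of_forall hf hs _ T m a le_rfl g⟩
  rw [sup_comm]
  exact mem_sup_of_le_of_le (foldIdeal_le_pow f m _ A) le_rfl h

theorem mul_mem_foldIdeal_sup_iff (hf : RegularUpTo f r) (hs : SpannedBy f r)
    {T : Finset (Fin s)} {j : Fin s} (hj : 0 < m j) (hjT : j ∉ T) (hT : T.card < r) {g : R} :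
    f j * g ∈ foldIdeal f m (a + 1) ⊔ indexIdeal f T ↔
      g ∈ foldIdeal f (Function.update m j (m j - 1)) a ⊔ indexIdeal f T := by
  constructor
  · intro h
    rw [mem_foldIdeal_sup_iff hf hs] at h ⊢
    exact mem_sup_pow_mu_of_mul_mem hf hs hj hjT hT h
  · intro h
    obtain ⟨x, hx, t, ht, rfl⟩ := Submodule.mem_sup.1 h
    rw [mul_add]
    exact Submodule.add_mem_sup (mul_mem_foldIdeal hj hx) (Ideal.mul_mem_left _ _ ht)

theorem foldIdeal_eq_iInf (hf : RegularUpTo f r) (hs : SpannedBy f r) (ham : a ≤ ∑ i, m i) :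
    foldIdeal f m a =
      ⨅ c ∈ Finset.Icc 1 s, ⨅ A ∈ Finset.powersetCard c (Finset.univ : Finset (Fin s)),
        indexIdeal f A ^ mu m a A := by
  refine le_antisymm ?_ fun g hg => ?_
  · simp only [le_iInf_iff]
    exact fun _ _ A _ => foldIdeal_le_pow f m a A
  · have h1 := (mem_foldIdeal_sup_iff hf hs (T := ∅) (m := m) (a := a) (g := g)).2 fun A => by
      rcases A.eq_empty_or_nonempty with rfl | hA
      -- The intersection omits `A = ∅`; `a ≤ ∑ i, m i` makes that condition vacuous.
      · have : mu m a ∅ = 0 := by simpa [mu] using Nat.sub_eq_zero_of_le ham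
        simp [this]
      · simp only [Submodule.mem_iInf] at hg
        refine Ideal.mem_sup_right (hg A.card (Finset.mem_Icc.2 ⟨hA.card_pos, ?_⟩) A (by simp))
        simpa using A.card_le_univ
    simpa [indexIdeal] using h1

theorem foldIdeal_colon (hf : RegularUpTo f r) (hs : SpannedBy f r) (hr : 0 < r) (k : Fin s) :
    (foldIdeal f (Function.update m k (m k + 1)) (a + 1)).colon {f k} = foldIdeal f m a := by
  ext g
  have := mul_mem_foldIdeal_sup_iff hf hs (T := ∅) (m := Function.update m k (m k + 1)) (a := a)
    (j := k) (g := g) (by simp) (by simp) (by simpa using hr)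
  have h0 : indexIdeal f ∅ = ⊥ := by simp [indexIdeal]
  simp only [Function.update_self, Function.update_idem, Nat.add_sub_cancel,
    Function.update_eq_self, h0, sup_bot_eq] at this
  rw [Submodule.mem_colon_singleton, smul_eq_mul, mul_comm, this]

end FoldIdeal

end Ring

/-! ### Linear resolutions, absolute and relative, and the horseshoe construction. -/

section LinearResolution

variable {K : Type*} [Field K] {σ : Type*}

/-- The ideal contains all homogeneous components of its elements. -/
def IsGradedIdeal (P : Ideal (MvPolynomial σ K)) : Prop :=
  ∀ x ∈ P, ∀ n, homogeneousComponent n x ∈ P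

lemma IsGradedIdeal.sup {P Q : Ideal (MvPolynomial σ K)} (hP : IsGradedIdeal P)
    (hQ : IsGradedIdeal Q) : IsGradedIdeal (P ⊔ Q) := by
  intro x hx n
  obtain ⟨p, hp, q, hq, rfl⟩ := Submodule.mem_sup.1 hx
  rw [map_add]
  exact Submodule.add_mem_sup (hP p hp n) (hQ q hq n)

lemma isGradedIdeal_of_isHomogeneous {P : Ideal (MvPolynomial σ K)}
    (hP : P.IsHomogeneous (homogeneousSubmodule σ K)) : IsGradedIdeal P := fun _ hx n =>
  homogeneousComponent_mem_of_mem hP hx n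

lemma homogeneousComponent_mul_of_isHomogeneous {e : ℕ} {w : MvPolynomial σ K}
    (hw : w.IsHomogeneous e) (c : MvPolynomial σ K) (n : ℕ) :
    homogeneousComponent (n + e) (c * w) = homogeneousComponent n c * w := by
  classical
  conv_lhs => rw [← sum_homogeneousComponent c, Finset.sum_mul, map_sum]
  have h : ∀ i, homogeneousComponent (n + e) (homogeneousComponent i c * w) =
      if i = n then homogeneousComponent n c * w else 0 := by
    intro i
    have hi : (homogeneousComponent i c * w).IsHomogeneous (i + e) :=
      (homogeneousComponent_isHomogeneous i c).mul hw
    rw [homogeneousComponent_of_mem hi]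
    by_cases hin : i = n
    · subst hin; simp
    · rw [if_neg (by omega), if_neg hin]
  simp only [h, Finset.sum_ite_eq', Finset.mem_range]
  split_ifs with hlt
  · rfl
  · rw [homogeneousComponent_eq_zero _ _ (by omega), zero_mul]

/-- The coordinatewise homogeneous component of a vector. -/
noncomputable def vecComponent {ι : Type} (n : ℕ) (c : ι →₀ MvPolynomial σ K) :
    ι →₀ MvPolynomial σ K :=
  c.mapRange (homogeneousComponent n) (map_zero _)

@[simp] lemma vecComponent_apply {ι : Type} (n : ℕ) (c : ι →₀ MvPolynomial σ K) (i : ι) :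
    vecComponent n c i = homogeneousComponent n (c i) := rfl

lemma linearCombination_vecComponent {κ : Type} {e : ℕ} {v : κ → MvPolynomial σ K}
    (hv : ∀ j, (v j).IsHomogeneous e) (n : ℕ) (c : κ →₀ MvPolynomial σ K) :
    Finsupp.linearCombination (MvPolynomial σ K) v (vecComponent n c) =
      homogeneousComponent (n + e) (Finsupp.linearCombination (MvPolynomial σ K) v c) := by
  induction c using Finsupp.induction_linear with
  | zero => simp [vecComponent]
  | add x y hx hy =>
    have : vecComponent n (x + y) = vecComponent n x + vecComponent n y := by ext; simp
    rw [this, map_add, map_add, hx, hy, map_add]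
  | single j p =>
    rw [vecComponent, Finsupp.mapRange_single, Finsupp.linearCombination_single,
      Finsupp.linearCombination_single, smul_eq_mul, smul_eq_mul,
      homogeneousComponent_mul_of_isHomogeneous (hv j)]

lemma linearCombination_coord {κ ι : Type} (w : κ → ι →₀ MvPolynomial σ K)
    (c : κ →₀ MvPolynomial σ K) (i : ι) :
    Finsupp.linearCombination (MvPolynomial σ K) w c i =
      Finsupp.linearCombination (MvPolynomial σ K) (fun j => w j i) c := by
  simp [Finsupp.linearCombination_apply, Finsupp.sum, Finsupp.finsetSum_apply]

/-- The submodule of a free module contains all homogeneous components of its elements. -/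
def IsGradedSubmodule {ι : Type} (S : Submodule (MvPolynomial σ K) (ι →₀ MvPolynomial σ K)) :
    Prop :=
  ∀ x ∈ S, ∀ n, vecComponent n x ∈ S

/-- All entries have the same degree `e`, so taking coordinatewise components commutes with the map
up to a uniform shift. -/
lemma isGradedSubmodule_ker {κ ι : Type} {e : ℕ} {w : κ → ι →₀ MvPolynomial σ K}
    (hw : ∀ j i, (w j i).IsHomogeneous e) :
    IsGradedSubmodule (LinearMap.ker (Finsupp.linearCombination (MvPolynomial σ K) w)) := by
  intro x hx n
  rw [LinearMap.mem_ker] at hx ⊢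
  ext1 i
  rw [linearCombination_coord, linearCombination_vecComponent (fun j => hw j i),
    ← linearCombination_coord, hx]
  simp

lemma isGradedSubmodule_comap {κ : Type} {e : ℕ} {v : κ → MvPolynomial σ K}
    (hv : ∀ j, (v j).IsHomogeneous e) {P : Ideal (MvPolynomial σ K)} (hP : IsGradedIdeal P) :
    IsGradedSubmodule (Submodule.comap (Finsupp.linearCombination (MvPolynomial σ K) v) P) := by
  intro x hx n
  rw [Submodule.mem_comap, linearCombination_vecComponent hv]
  exact hP _ hx _

/-- The submodule `S` of a free module is generated by finitely many vectors with coordinates of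
degree `e`, and has a free resolution of length `< k` whose further maps have entries of
degree `d`. -/
def HasLinearResolution (d : ℕ) : ℕ → ℕ → ∀ {ι : Type},
    Submodule (MvPolynomial σ K) (ι →₀ MvPolynomial σ K) → Prop
  | 0, _, _, S => S = ⊥
  | k + 1, e, ι, S => ∃ (κ : Type) (_ : Finite κ) (w : κ → ι →₀ MvPolynomial σ K),
      (∀ j i, (w j i).IsHomogeneous e) ∧ Submodule.span _ (Set.range w) = S ∧
        HasLinearResolution d k d
          (LinearMap.ker (Finsupp.linearCombination (MvPolynomial σ K) w))

variable {d : ℕ}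

lemma hasLinearResolution_bot (k e : ℕ) {ι : Type} :
    HasLinearResolution d k e (⊥ : Submodule (MvPolynomial σ K) (ι →₀ MvPolynomial σ K)) := by
  induction k generalizing e ι with
  | zero => rfl
  | succ k ih =>
    refine ⟨Empty, inferInstance, Empty.elim, fun j => j.elim, by simp, ?_⟩
    rw [Subsingleton.elim (LinearMap.ker _) ⊥]
    exact ih d

lemma HasLinearResolution.mono {k l e : ℕ} (hkl : k ≤ l) {ι : Type}
    {S : Submodule (MvPolynomial σ K) (ι →₀ MvPolynomial σ K)}
    (h : HasLinearResolution d k e S) : HasLinearResolution d l e S := by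
  induction k generalizing l e ι with
  | zero =>
    obtain rfl : S = ⊥ := h
    exact hasLinearResolution_bot _ _
  | succ k ih =>
    obtain ⟨l, rfl⟩ : ∃ l', l = l' + 1 := ⟨l - 1, by omega⟩
    obtain ⟨κ, hκ, w, h1, h2, h3⟩ := h
    exact ⟨κ, hκ, w, h1, h2, ih (by omega) h3⟩

section Sum

variable {R M : Type*} [CommRing R] [AddCommGroup M] [Module R M] {α β : Type}

variable (R α β) in
/-- The inclusion of the first summand. -/
noncomputable abbrev freeInl : (α →₀ R) →ₗ[R] (α ⊕ β →₀ R) := Finsupp.lmapDomain R R Sum.inl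

variable (R α β) in
/-- The inclusion of the second summand. -/
noncomputable abbrev freeInr : (β →₀ R) →ₗ[R] (α ⊕ β →₀ R) := Finsupp.lmapDomain R R Sum.inr

variable (R α β) in
/-- The projection to the first summand. -/
noncomputable abbrev freeFst : (α ⊕ β →₀ R) →ₗ[R] (α →₀ R) :=
  Finsupp.lcomapDomain Sum.inl Sum.inl_injective

variable (R α β) in
/-- The projection to the second summand. -/
noncomputable abbrev freeSnd : (α ⊕ β →₀ R) →ₗ[R] (β →₀ R) :=
  Finsupp.lcomapDomain Sum.inr Sum.inr_injective

lemma freeInl_add_freeInr (x : α ⊕ β →₀ R) :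
    freeInl R α β (freeFst R α β x) + freeInr R α β (freeSnd R α β x) = x := by
  ext (i | i)
  · simp [Finsupp.mapDomain_apply Sum.inl_injective, Finsupp.mapDomain_of_notMem_range]
  · simp [Finsupp.mapDomain_apply Sum.inr_injective, Finsupp.mapDomain_of_notMem_range]

lemma freeSnd_freeInl (x : α →₀ R) : freeSnd R α β (freeInl R α β x) = 0 := by
  ext i
  simp [Finsupp.mapDomain_of_notMem_range]

lemma freeSnd_freeInr (x : β →₀ R) : freeSnd R α β (freeInr R α β x) = x := by
  ext i
  simp [Finsupp.mapDomain_apply Sum.inr_injective]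

lemma linearCombination_freeInl (v : α → M) (w : β → M) (c : α →₀ R) :
    Finsupp.linearCombination R (Sum.elim v w) (freeInl R α β c) =
      Finsupp.linearCombination R v c := by
  simp [Finsupp.linearCombination_mapDomain]

lemma linearCombination_freeInr (v : α → M) (w : β → M) (c : β →₀ R) :
    Finsupp.linearCombination R (Sum.elim v w) (freeInr R α β c) =
      Finsupp.linearCombination R w c := by
  simp [Finsupp.linearCombination_mapDomain]

end Sum

lemma freeInl_injective {R : Type*} [CommRing R] {α β : Type} :
    Function.Injective (freeInl R α β) :=
  Finsupp.mapDomain_injective Sum.inl_injective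

lemma freeFst_mem_comap {R : Type*} [CommRing R] {α β : Type}
    {S : Submodule R (α ⊕ β →₀ R)} {x : α ⊕ β →₀ R} (hx : x ∈ S) (h : freeSnd R α β x = 0) :
    freeFst R α β x ∈ S.comap (freeInl R α β) := by
  have := freeInl_add_freeInr x
  rw [h, map_zero, add_zero] at this
  rwa [Submodule.mem_comap, this]

/-- A graded submodule of a direct sum has a linear resolution if its intersection with the first
summand and its projection to the second one have. -/
theorem HasLinearResolution.of_comap_of_map {k e : ℕ} {α β : Type}
    {S : Submodule (MvPolynomial σ K) (α ⊕ β →₀ MvPolynomial σ K)} (hS : IsGradedSubmodule S)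
    (hα : HasLinearResolution d k e (S.comap (freeInl (MvPolynomial σ K) α β)))
    (hβ : HasLinearResolution d k e (S.map (freeSnd (MvPolynomial σ K) α β))) :
    HasLinearResolution d k e S := by
  induction k generalizing e α β with
  | zero =>
    have hα' : S.comap (freeInl (MvPolynomial σ K) α β) = ⊥ := hα
    have hβ' : S.map (freeSnd (MvPolynomial σ K) α β) = ⊥ := hβ
    refine (Submodule.eq_bot_iff _).2 fun x hx => ?_
    have h1 : freeSnd (MvPolynomial σ K) α β x = 0 := by
      rw [← Submodule.mem_bot (MvPolynomial σ K), ← hβ']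
      exact Submodule.mem_map_of_mem hx
    have h2 := freeFst_mem_comap hx h1
    rw [hα', Submodule.mem_bot] at h2
    rw [← freeInl_add_freeInr x, h1, h2, map_zero, map_zero, add_zero]
  | succ k ih =>
    obtain ⟨κ, _, v, hv, hvS, hvk⟩ := hα
    obtain ⟨κ', _, w, hw, hwS, hwk⟩ := hβ
    -- Generators of the projection lift to `S`; gradedness of `S` allows the degree `e` component
    -- of a lift, which still projects to `w j`.
    have hlift : ∀ j, ∃ y ∈ S, (∀ i, (y i).IsHomogeneous e) ∧
        freeSnd (MvPolynomial σ K) α β y = w j := by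
      intro j
      have : w j ∈ S.map (freeSnd (MvPolynomial σ K) α β) := hwS ▸ Submodule.subset_span ⟨j, rfl⟩
      obtain ⟨x, hx, hxw⟩ := this
      refine ⟨vecComponent e x, hS x hx e, fun i => homogeneousComponent_isHomogeneous _ _, ?_⟩
      ext1 i
      have h1 : x (Sum.inr i) = w j i := DFunLike.congr_fun hxw i
      have h2 : homogeneousComponent e (w j i) = w j i := by
        rw [homogeneousComponent_of_mem (hw j i), if_pos rfl]
      simp [h1, h2]
    choose y hyS hyh hyw using hlift
    have hlv : ∀ c, Finsupp.linearCombination (MvPolynomial σ K)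
        (fun j => freeInl (MvPolynomial σ K) α β (v j)) c =
          freeInl (MvPolynomial σ K) α β (Finsupp.linearCombination (MvPolynomial σ K) v c) :=
      fun c => by simp only [Finsupp.linearCombination_apply, Finsupp.sum, map_sum, map_smul]
    have hly : ∀ c, freeSnd (MvPolynomial σ K) α β
        (Finsupp.linearCombination (MvPolynomial σ K) y c) =
          Finsupp.linearCombination (MvPolynomial σ K) w c := fun c => by
      simp only [Finsupp.linearCombination_apply, Finsupp.sum, map_sum, map_smul, hyw]
    have hlS : ∀ c, Finsupp.linearCombination (MvPolynomial σ K) y c ∈ S := fun c =>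
      Submodule.sum_mem _ fun j _ => S.smul_mem _ (hyS j)
    set u : κ ⊕ κ' → α ⊕ β →₀ MvPolynomial σ K :=
      Sum.elim (fun j => freeInl (MvPolynomial σ K) α β (v j)) y with hu
    have huh : ∀ j i, (u j i).IsHomogeneous e := by
      rintro (j | j) i
      · rcases i with i | i
        · simpa [hu, Finsupp.mapDomain_apply Sum.inl_injective] using hv j i
        · simpa [hu, Finsupp.mapDomain_of_notMem_range] using isHomogeneous_zero _ _ _
      · exact hyh j i
    refine ⟨κ ⊕ κ', inferInstance, u, huh, le_antisymm ?_ ?_,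
      ih (isGradedSubmodule_ker huh) ?_ ?_⟩
    · rw [Submodule.span_le]
      rintro _ ⟨j | j, rfl⟩
      · have : v j ∈ S.comap (freeInl (MvPolynomial σ K) α β) :=
          hvS ▸ Submodule.subset_span ⟨j, rfl⟩
        exact this
      · exact hyS j
    · intro x hx
      have h1 : freeSnd (MvPolynomial σ K) α β x ∈ Submodule.span _ (Set.range w) :=
        hwS ▸ Submodule.mem_map_of_mem hx
      rw [← Finsupp.range_linearCombination] at h1
      obtain ⟨c', hc'⟩ := h1
      have h2 : x - Finsupp.linearCombination (MvPolynomial σ K) y c' ∈ S := sub_mem hx (hlS c')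
      have h3 : freeSnd (MvPolynomial σ K) α β
          (x - Finsupp.linearCombination (MvPolynomial σ K) y c') = 0 := by
        rw [map_sub, hly, hc', sub_self]
      have h4 := freeFst_mem_comap h2 h3
      rw [← hvS, ← Finsupp.range_linearCombination] at h4
      obtain ⟨c, hc⟩ := h4
      have h5 := freeInl_add_freeInr (x - Finsupp.linearCombination (MvPolynomial σ K) y c')
      rw [h3, map_zero, add_zero, ← hc] at h5
      rw [← Finsupp.range_linearCombination]
      refine ⟨freeInl _ _ _ c + freeInr _ _ _ c', ?_⟩
      rw [map_add, linearCombination_freeInl, linearCombination_freeInr, hlv, h5, sub_add_cancel]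
    · convert hvk using 1
      ext c
      rw [Submodule.mem_comap, LinearMap.mem_ker, LinearMap.mem_ker, linearCombination_freeInl,
        hlv, map_eq_zero_iff _ freeInl_injective]
    · convert hwk using 1
      ext c'
      rw [LinearMap.mem_ker]
      constructor
      · rintro ⟨x, hx, rfl⟩
        have h1 : Finsupp.linearCombination (MvPolynomial σ K) u x = 0 := hx
        rw [← freeInl_add_freeInr x, map_add, linearCombination_freeInl,
          linearCombination_freeInr, hlv] at h1
        have := congrArg (freeSnd (MvPolynomial σ K) α β) h1
        rwa [map_add, freeSnd_freeInl, zero_add, hly, map_zero] at this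
      · intro hc'
        have h1 := freeFst_mem_comap (hlS c') ((hly c').trans hc')
        rw [← hvS, ← Finsupp.range_linearCombination] at h1
        obtain ⟨c, hc⟩ := h1
        -- A syzygy of `w` sends the lifts `y` into the first summand, where the value is a
        -- combination of `v`; subtracting it completes the syzygy to one of `u`.
        refine ⟨freeInr _ _ _ c' - freeInl _ _ _ c, ?_, ?_⟩
        · have h2 := freeInl_add_freeInr (Finsupp.linearCombination (MvPolynomial σ K) y c')
          rw [(hly c').trans hc', map_zero, add_zero, ← hc] at h2
          change Finsupp.linearCombination (MvPolynomial σ K) u _ = 0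
          rw [map_sub, linearCombination_freeInl, linearCombination_freeInr, hlv, h2, sub_self]
        · rw [map_sub, freeSnd_freeInl, freeSnd_freeInr, sub_zero]

/-- The quotient `N / (N ∩ P)` is generated by finitely many forms of degree `e`, and its
syzygies have a finite linear resolution with steps of degree `d`. -/
def HasRelativeLinearResolution (d e : ℕ) (N P : Ideal (MvPolynomial σ K)) : Prop :=
  ∃ (κ : Type) (_ : Finite κ) (v : κ → MvPolynomial σ K),
    (∀ j, (v j).IsHomogeneous e) ∧ (∀ j, v j ∈ N) ∧ N ≤ Ideal.span (Set.range v) ⊔ P ∧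
      ∃ k, HasLinearResolution d k d
        (Submodule.comap (Finsupp.linearCombination (MvPolynomial σ K) v) P)

lemma hasRelativeLinearResolution_of_le {e : ℕ} {N P : Ideal (MvPolynomial σ K)} (h : N ≤ P) :
    HasRelativeLinearResolution d e N P := by
  refine ⟨Empty, inferInstance, Empty.elim, fun j => j.elim, fun j => j.elim,
    le_sup_of_le_right h, 0, Subsingleton.elim _ _⟩

/-- Horseshoe lemma for `0 → Q / P → N / P → N / Q → 0`: the relations on the joint generators meet
the first summand in those of `Q / P` and project onto those of `N / Q`. -/
theorem HasRelativeLinearResolution.trans {e : ℕ} {N Q P : Ideal (MvPolynomial σ K)}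
    (hP : IsGradedIdeal P) (hPQ : P ≤ Q) (hQN : Q ≤ N)
    (h₁ : HasRelativeLinearResolution d e Q P) (h₂ : HasRelativeLinearResolution d e N Q) :
    HasRelativeLinearResolution d e N P := by
  obtain ⟨κ, _, v, hv, hvQ, hQ, k, hk⟩ := h₁
  obtain ⟨κ', _, w, hw, hwN, hN, l, hl⟩ := h₂
  have hh : ∀ j, (Sum.elim v w j).IsHomogeneous e := by
    rintro (j | j)
    exacts [hv j, hw j]
  have hlv : ∀ c, Finsupp.linearCombination (MvPolynomial σ K) v c ∈ Q := fun c =>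
    Submodule.sum_mem _ fun j _ => Q.smul_mem _ (hvQ j)
  refine ⟨κ ⊕ κ', inferInstance, Sum.elim v w, hh, ?_, ?_, max k l,
    HasLinearResolution.of_comap_of_map (isGradedSubmodule_comap hh hP) ?_ ?_⟩
  · rintro (j | j)
    exacts [hQN (hvQ j), hwN j]
  · rw [Set.Sum.elim_range, Ideal.span_union]
    refine hN.trans (sup_le (le_sup_of_le_left le_sup_right) (hQ.trans ?_))
    exact sup_le_sup le_sup_left le_rfl
  · convert hk.mono (le_max_left k l) using 1
    ext c
    simp only [Submodule.mem_comap, linearCombination_freeInl]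
  · convert hl.mono (le_max_right k l) using 1
    ext c'
    constructor
    · rintro ⟨x, hx, rfl⟩
      have h1 : Finsupp.linearCombination (MvPolynomial σ K) (Sum.elim v w) x ∈ P := hx
      rw [← freeInl_add_freeInr x, map_add, linearCombination_freeInl,
        linearCombination_freeInr] at h1
      exact (Submodule.add_mem_iff_right _ (hlv _)).1 (hPQ h1)
    · intro hc'
      obtain ⟨y, hy, p, hp, h1⟩ := Submodule.mem_sup.1 (hQ hc')
      rw [Ideal.span, ← Finsupp.range_linearCombination] at hy
      obtain ⟨c, rfl⟩ := hy
      refine ⟨freeInr _ _ _ c' - freeInl _ _ _ c, ?_, ?_⟩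
      · change Finsupp.linearCombination (MvPolynomial σ K) (Sum.elim v w) _ ∈ P
        rw [map_sub, linearCombination_freeInl, linearCombination_freeInr, ← h1,
          add_sub_cancel_left]
        exact hp
      · rw [map_sub, freeSnd_freeInl, freeSnd_freeInr, sub_zero]

/-- The isomorphism `N / (N ⊓ Q) ≅ (N ⊔ Q) / Q`; generators are replaced by homogeneous
representatives in `N`, which have the same relations. -/
theorem HasRelativeLinearResolution.inf_right {e : ℕ} {N Q : Ideal (MvPolynomial σ K)}
    (hN : IsGradedIdeal N) (hQ : IsGradedIdeal Q)
    (h : HasRelativeLinearResolution d e (N ⊔ Q) Q) :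
    HasRelativeLinearResolution d e N (N ⊓ Q) := by
  obtain ⟨κ, _, v, hv, hvN, hle, k, hk⟩ := h
  have hlift : ∀ j, ∃ y ∈ N, y.IsHomogeneous e ∧ v j - y ∈ Q := by
    intro j
    obtain ⟨x, hx, q, hq, hxq⟩ := Submodule.mem_sup.1 (hvN j)
    refine ⟨_, hN x hx e, homogeneousComponent_isHomogeneous _ _, ?_⟩
    have h2 : homogeneousComponent e (v j) = v j := by
      rw [homogeneousComponent_of_mem (hv j), if_pos rfl]
    rw [← h2, ← map_sub, ← hxq, add_sub_cancel_left]
    exact hQ q hq e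
  choose y hyN hyh hyQ using hlift
  have hdiff : ∀ c, Finsupp.linearCombination (MvPolynomial σ K) v c -
      Finsupp.linearCombination (MvPolynomial σ K) y c ∈ Q := fun c => by
    simp only [Finsupp.linearCombination_apply, Finsupp.sum, ← Finset.sum_sub_distrib, ← smul_sub]
    exact Submodule.sum_mem _ fun j _ => Q.smul_mem _ (hyQ j)
  have hly : ∀ c, Finsupp.linearCombination (MvPolynomial σ K) y c ∈ N := fun c =>
    Submodule.sum_mem _ fun j _ => N.smul_mem _ (hyN j)
  refine ⟨κ, inferInstance, y, hyh, hyN, fun x hx => ?_, k, ?_⟩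
  · obtain ⟨z, hz, q, hq, rfl⟩ := Submodule.mem_sup.1 (hle (Ideal.mem_sup_left hx))
    rw [Ideal.span, ← Finsupp.range_linearCombination] at hz
    obtain ⟨c, rfl⟩ := hz
    refine Submodule.mem_sup.2 ⟨Finsupp.linearCombination (MvPolynomial σ K) y c, ?_,
      _, ⟨sub_mem hx (hly c), ?_⟩, add_sub_cancel _ _⟩
    · rw [Ideal.span, ← Finsupp.range_linearCombination]
      exact ⟨c, rfl⟩
    · rw [add_sub_right_comm]
      exact add_mem (hdiff c) hq
  · convert hk using 1
    ext c
    simp only [Submodule.mem_comap, Submodule.mem_inf, hly c, true_and]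
    exact ⟨fun h => by simpa using add_mem (hdiff c) h,
      fun h => by simpa using sub_mem h (hdiff c)⟩

/-- Multiplication by an element regular modulo `P` shifts the generators and leaves their relations
unchanged. -/
theorem HasRelativeLinearResolution.mul {e e' : ℕ} {N P : Ideal (MvPolynomial σ K)}
    {l : MvPolynomial σ K} (hl : l.IsHomogeneous e') (hreg : ∀ g, l * g ∈ P → g ∈ P)
    (h : HasRelativeLinearResolution d e N P) :
    HasRelativeLinearResolution d (e' + e) (Ideal.span {l} * N ⊔ P) P := by
  obtain ⟨κ, _, v, hv, hvN, hle, k, hk⟩ := h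
  have hlv : ∀ c, Finsupp.linearCombination (MvPolynomial σ K) (fun j => l * v j) c =
      l * Finsupp.linearCombination (MvPolynomial σ K) v c := fun c => by
    simp only [Finsupp.linearCombination_apply, Finsupp.sum, Finset.mul_sum, smul_eq_mul,
      mul_left_comm]
  refine ⟨κ, inferInstance, fun j => l * v j, fun j => hl.mul (hv j), fun j => ?_,
    sup_le ?_ le_sup_right, k, ?_⟩
  · exact Ideal.mem_sup_left (Ideal.mul_mem_mul (Ideal.mem_span_singleton_self l) (hvN j))
  · intro x hx
    obtain ⟨z, hz, rfl⟩ := Ideal.mem_span_singleton_mul.1 hx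
    obtain ⟨y, hy, p, hp, rfl⟩ := Submodule.mem_sup.1 (hle hz)
    rw [Ideal.span, ← Finsupp.range_linearCombination] at hy
    obtain ⟨c, rfl⟩ := hy
    rw [mul_add, ← hlv]
    refine Submodule.add_mem_sup ?_ (Ideal.mul_mem_left _ _ hp)
    rw [Ideal.span, ← Finsupp.range_linearCombination]
    exact ⟨c, rfl⟩
  · convert hk using 1
    ext c
    simp only [Submodule.mem_comap, hlv]
    exact ⟨hreg _, Ideal.mul_mem_left _ _⟩

theorem HasRelativeLinearResolution.hasLinearResolution {e : ℕ} {P : Ideal (MvPolynomial σ K)}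
    (h : HasRelativeLinearResolution d e P ⊥) :
    ∃ k, HasLinearResolution d k e (Submodule.comap (Finsupp.lapply ()) P :
      Submodule (MvPolynomial σ K) (Unit →₀ MvPolynomial σ K)) := by
  obtain ⟨κ, _, v, hv, hvP, hle, k, hk⟩ := h
  have hlv : ∀ c, Finsupp.linearCombination (MvPolynomial σ K)
      (fun j => Finsupp.single () (v j)) c =
        Finsupp.single () (Finsupp.linearCombination (MvPolynomial σ K) v c) := fun c => by
    ext1
    rw [linearCombination_coord]
    simp
  refine ⟨k + 1, κ, inferInstance, fun j => Finsupp.single () (v j), fun j i => by simpa using hv j,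
    le_antisymm ?_ ?_, ?_⟩
  · rw [Submodule.span_le]
    rintro _ ⟨j, rfl⟩
    simpa using hvP j
  · intro x hx
    have := hle hx
    rw [sup_bot_eq, Ideal.span, ← Finsupp.range_linearCombination] at this
    obtain ⟨c, hc⟩ := this
    rw [← Finsupp.range_linearCombination]
    refine ⟨c, ?_⟩
    rw [hlv, hc]
    ext1
    simp
  · convert hk using 1
    ext c
    simp [hlv]

/-- `R / P` has the single generator `1`, with relations `P`; generation of `P` in degree `d`, the
degree of a step, makes this first step linear too. -/
theorem hasRelativeLinearResolution_top {P : Ideal (MvPolynomial σ K)}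
    (h : HasRelativeLinearResolution d d P ⊥) : HasRelativeLinearResolution d 0 ⊤ P := by
  obtain ⟨k, hk⟩ := h.hasLinearResolution
  refine ⟨Unit, inferInstance, fun _ => 1, fun _ => isHomogeneous_one _ _, fun _ => trivial, ?_,
    k, ?_⟩
  · refine le_sup_of_le_left (le_of_eq ?_)
    rw [eq_comm, Ideal.eq_top_iff_one]
    exact Ideal.subset_span ⟨(), rfl⟩
  · convert hk using 2
    ext1
    ext1
    simp

end LinearResolution

/-! ### From linear resolutions to minimal graded free resolutions and Betti tables. -/

section Resolution

variable {K : Type*} [Field K] {σ : Type*} {d : ℕ}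

/-- Padding the length by one treats length `0` like the others, and hiding the length in an
existential lets the step be iterated indefinitely. -/
lemma HasLinearResolution.exists_generators {k e : ℕ} {ι : Type}
    {S : Submodule (MvPolynomial σ K) (ι →₀ MvPolynomial σ K)}
    (h : HasLinearResolution d k e S) :
    ∃ (κ : Type) (_ : Finite κ) (w : κ → ι →₀ MvPolynomial σ K),
      (∀ j i, (w j i).IsHomogeneous e) ∧ Submodule.span _ (Set.range w) = S ∧
        ∃ k, HasLinearResolution d k d
          (LinearMap.ker (Finsupp.linearCombination (MvPolynomial σ K) w)) := by
  obtain ⟨κ, hκ, w, h1, h2, h3⟩ := h.mono k.le_succ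
  exact ⟨κ, hκ, w, h1, h2, k, h3⟩

variable (K σ d) in
/-- A stage in the construction of a resolution: a free module with basis in degree `deg`, and a
submodule, generated in degree `deg + e`, that is still to be resolved. -/
structure ResolutionStage where
  ι : Type
  finite_ι : Finite ι
  S : Submodule (MvPolynomial σ K) (ι →₀ MvPolynomial σ K)
  e : ℕ
  deg : ℕ
  exists_resolution : ∃ k, HasLinearResolution d k e S

namespace ResolutionStage

variable (s : ResolutionStage K σ d)

/-- The basis of the next free module. -/
def nextIndex : Type := s.exists_resolution.choose_spec.exists_generators.choose

lemma finite_nextIndex : Finite s.nextIndex :=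
  s.exists_resolution.choose_spec.exists_generators.choose_spec.choose

/-- The differential on the basis of the next free module. -/
noncomputable def generator : s.nextIndex → s.ι →₀ MvPolynomial σ K :=
  s.exists_resolution.choose_spec.exists_generators.choose_spec.choose_spec.choose

lemma generator_spec : (∀ j i, (s.generator j i).IsHomogeneous s.e) ∧
    Submodule.span _ (Set.range s.generator) = s.S ∧
      ∃ k, HasLinearResolution d k d
        (LinearMap.ker (Finsupp.linearCombination (MvPolynomial σ K) s.generator)) :=
  s.exists_resolution.choose_spec.exists_generators.choose_spec.choose_spec.choose_spec

/-- The next stage. -/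
noncomputable def next : ResolutionStage K σ d where
  ι := s.nextIndex
  finite_ι := s.finite_nextIndex
  S := LinearMap.ker (Finsupp.linearCombination (MvPolynomial σ K) s.generator)
  e := d
  deg := s.deg + s.e
  exists_resolution := s.generator_spec.2.2

/-- The differential. -/
noncomputable def differential :
    (s.next.ι →₀ MvPolynomial σ K) →ₗ[MvPolynomial σ K] (s.ι →₀ MvPolynomial σ K) :=
  Finsupp.linearCombination (MvPolynomial σ K) s.generator

lemma range_differential : LinearMap.range s.differential = s.S := by
  rw [← s.generator_spec.2.1]
  exact Finsupp.range_linearCombination _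

lemma degree_of_coeff_differential_ne_zero {l : s.next.ι} {k : s.ι} {u : σ →₀ ℕ}
    (hu : coeff u (s.differential (Finsupp.single l 1) k) ≠ 0) :
    u.degree + s.deg = s.next.deg := by
  have h1 : s.differential (Finsupp.single l 1) = s.generator l :=
    (Finsupp.linearCombination_single _ _ _).trans (one_smul _ _)
  rw [h1] at hu
  have h2 := mt ((s.generator_spec.1 l k).coeff_eq_zero (d := u)) hu
  rw [not_not.1 h2, add_comm]
  rfl

lemma exact_differential : Function.Exact s.next.differential s.differential := by
  rw [LinearMap.exact_iff]
  exact s.next.range_differential.symm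

/-- The `i`-th stage of the construction. -/
noncomputable def iter : ℕ → ResolutionStage K σ d
  | 0 => s
  | i + 1 => (iter i).next

lemma iter_succ_deg (i : ℕ) : (s.iter (i + 1)).deg = s.deg + s.e + d * i := by
  induction i with
  | zero => rfl
  | succ i ih =>
    change (s.iter (i + 1)).deg + d = _
    rw [ih]
    ring

end ResolutionStage

/-- The first stage in the resolution of `R / I`. -/
noncomputable def initialStage {e : ℕ} {I : Ideal (MvPolynomial σ K)}
    (h : HasRelativeLinearResolution d e I ⊥) : ResolutionStage K σ d where
  ι := Unit
  finite_ι := inferInstance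
  S := Submodule.comap (Finsupp.lapply ()) I
  e := e
  deg := 0
  exists_resolution := h.hasLinearResolution

lemma exact_differential_mkQ {e : ℕ} {I : Ideal (MvPolynomial σ K)}
    (h : HasRelativeLinearResolution d e I ⊥) :
    Function.Exact (initialStage h).differential (Submodule.mkQ I ∘ₗ
      Finsupp.lapply (R := MvPolynomial σ K) (M := MvPolynomial σ K) ()) := by
  have h1 : LinearMap.ker (Submodule.mkQ I ∘ₗ
      Finsupp.lapply (R := MvPolynomial σ K) (M := MvPolynomial σ K) ()) =
        Submodule.comap (Finsupp.lapply ()) I := by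
    rw [LinearMap.ker_comp, Submodule.ker_mkQ]
  exact LinearMap.exact_iff.2 (h1.trans (initialStage h).range_differential.symm)

/-- The linear resolution of `R / I`. -/
noncomputable def linearResolution {e : ℕ} {I : Ideal (MvPolynomial σ K)}
    (h : HasRelativeLinearResolution d e I ⊥) : GradedFreeResolution I where
  ι i := ((initialStage h).iter i).ι
  finite_ι i := ((initialStage h).iter i).finite_ι
  deg i _ := ((initialStage h).iter i).deg
  d i := ((initialStage h).iter i).differential
  aug := Submodule.mkQ I ∘ₗ Finsupp.lapply (R := MvPolynomial σ K) (M := MvPolynomial σ K) ()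
  d_homogeneous i _ _ _ hu :=
    ((initialStage h).iter i).degree_of_coeff_differential_ne_zero hu
  aug_homogeneous k := ⟨1, isHomogeneous_one _ _, by
    have : (Finsupp.single k 1 : Unit →₀ MvPolynomial σ K) () = 1 := Finsupp.single_eq_same
    exact congrArg (Submodule.mkQ I) this⟩
  aug_surjective := by
    refine (Submodule.mkQ_surjective I).comp fun x => ⟨Finsupp.single () x, ?_⟩
    exact Finsupp.single_eq_same
  exact_zero := exact_differential_mkQ h
  exact_succ i := ((initialStage h).iter i).exact_differential

lemma maxIdeal_eq_idealOfVars : maxIdeal K σ = idealOfVars σ K := rfl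

lemma mem_maxIdeal_pow_of_isHomogeneous {e : ℕ} {p : MvPolynomial σ K} (hp : p.IsHomogeneous e) :
    p ∈ maxIdeal K σ ^ e := by
  rw [maxIdeal_eq_idealOfVars, mem_pow_idealOfVars_iff']
  exact fun u hu => hp.coeff_eq_zero (by omega)

lemma eq_zero_of_isHomogeneous_of_mem_maxIdeal_pow {e k : ℕ} (hek : e < k)
    {p : MvPolynomial σ K} (hp : p.IsHomogeneous e) (h : p ∈ maxIdeal K σ ^ k) : p = 0 := by
  rw [maxIdeal_eq_idealOfVars, mem_pow_idealOfVars_iff'] at h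
  ext u
  rw [coeff_zero]
  by_cases hu : u.degree = e
  · exact h u (by omega)
  · exact hp.coeff_eq_zero hu

lemma ResolutionStage.differential_mem_maxIdeal (s : ResolutionStage K σ d) (he : s.e ≠ 0)
    (v : s.next.ι →₀ MvPolynomial σ K) (k : s.ι) : s.differential v k ∈ maxIdeal K σ := by
  have h1 : s.differential v k = Finsupp.linearCombination (MvPolynomial σ K)
      (fun j => s.generator j k) v := linearCombination_coord _ _ _
  rw [h1]
  exact Submodule.sum_mem _ fun j _ => Ideal.mul_mem_left _ _
    (Ideal.pow_le_self he (mem_maxIdeal_pow_of_isHomogeneous (s.generator_spec.1 j k)))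

lemma linearResolution_isMinimal {e : ℕ} (hd : 0 < d) (he : 0 < e)
    {I : Ideal (MvPolynomial σ K)} (h : HasRelativeLinearResolution d e I ⊥) :
    (linearResolution h).IsMinimal := by
  intro i v k
  have he' : ((initialStage h).iter i).e ≠ 0 := by
    rcases i with _ | i
    · exact he.ne'
    · exact hd.ne'
  exact ((initialStage h).iter i).differential_mem_maxIdeal he' v k

/-- The resolution has one degree per step, `e + d * (i - 1)` for `i ≥ 1`, so only `e` has to be a
generator degree. The form `g` shows this: elements of `𝔪 I` lie in `𝔪 ^ (e + 1)`, where a nonzero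
form of degree `e` cannot lie. -/
theorem HasRelativeLinearResolution.hasKoszulStrandedBettiTable {e : ℕ} (hd : 0 < d) (he : 0 < e)
    {I : Ideal (MvPolynomial σ K)} (h : HasRelativeLinearResolution d e I ⊥)
    (hI : I.IsHomogeneous (homogeneousSubmodule σ K)) (hle : I ≤ maxIdeal K σ ^ e)
    {g : MvPolynomial σ K} (hgI : g ∈ I) (hg : g.IsHomogeneous e) (hg0 : g ≠ 0) :
    HasKoszulStrandedBettiTable I := by
  refine ⟨hI, ?_, _, ⟨linearResolution h, linearResolution_isMinimal hd he h, fun _ _ => rfl⟩,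
    d, hd, ?_⟩
  · rintro k ⟨p, hpI, hp, hpn⟩
    by_contra hk
    have := eq_zero_of_isHomogeneous_of_mem_maxIdeal_pow (by omega) hp (hle hpI)
    exact hpn (this ▸ zero_mem _)
  · intro i j hi hβ
    obtain ⟨i, rfl⟩ : ∃ i', i = i' + 1 := ⟨i - 1, by omega⟩
    obtain ⟨⟨_, hj⟩⟩ := (Nat.card_ne_zero.1 hβ).1
    refine ⟨e, ⟨g, hgI, hg, fun hmem => hg0 ?_⟩, ?_⟩
    · refine eq_zero_of_isHomogeneous_of_mem_maxIdeal_pow e.lt_succ_self hg ?_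
      rw [pow_succ']
      exact Ideal.mul_mono_right hle hmem
    · rw [← hj]
      refine (ResolutionStage.iter_succ_deg _ i).trans ?_
      simp [initialStage]

end Resolution

/-! ### Linear resolutions of fold ideals. -/

section Fold

variable {K : Type*} [Field K] {σ : Type*} {s d r : ℕ} {f : Fin s → MvPolynomial σ K}
  {m : Fin s → ℕ} {a : ℕ}

lemma isHomogeneous_indexIdeal (hd : ∀ i, (f i).IsHomogeneous d) (A : Finset (Fin s)) :
    (indexIdeal f A).IsHomogeneous (homogeneousSubmodule σ K) := by
  refine Ideal.homogeneous_span _ _ ?_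
  rintro _ ⟨i, _, rfl⟩
  exact ⟨d, hd i⟩

lemma isHomogeneous_prod_pow (hd : ∀ i, (f i).IsHomogeneous d) (e : Fin s → ℕ) :
    (∏ i, f i ^ e i).IsHomogeneous (d * ∑ i, e i) := by
  rw [Finset.mul_sum]
  exact IsHomogeneous.prod _ _ _ fun i _ => (hd i).pow _

lemma isHomogeneous_foldIdeal (hd : ∀ i, (f i).IsHomogeneous d) :
    (foldIdeal f m a).IsHomogeneous (homogeneousSubmodule σ K) := by
  refine Ideal.homogeneous_span _ _ ?_
  rintro _ ⟨e, _, _, rfl⟩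
  exact ⟨_, isHomogeneous_prod_pow hd e⟩

lemma foldIdeal_le_maxIdeal_pow (hd : ∀ i, (f i).IsHomogeneous d) :
    foldIdeal f m a ≤ maxIdeal K σ ^ (d * a) := by
  refine Ideal.span_le.2 ?_
  rintro _ ⟨e, _, rfl, rfl⟩
  exact mem_maxIdeal_pow_of_isHomogeneous (isHomogeneous_prod_pow hd e)

lemma exists_le_sum_eq (m : Fin s → ℕ) (ham : a ≤ ∑ i, m i) :
    ∃ e : Fin s → ℕ, (∀ i, e i ≤ m i) ∧ ∑ i, e i = a := by
  induction a with
  | zero => exact ⟨0, by simp, by simp⟩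
  | succ a ih =>
    obtain ⟨e, he, hs⟩ := ih (by omega)
    obtain ⟨j, -, hj⟩ : ∃ j ∈ Finset.univ, e j < m j :=
      Finset.exists_lt_of_sum_lt (by omega)
    refine ⟨e + Pi.single j 1, fun i => ?_, by simp [Finset.sum_add_distrib, hs]⟩
    rcases eq_or_ne i j with rfl | hij
    · simpa using hj
    · simpa [hij] using he i

theorem hasRelativeLinearResolution_indexIdeal (hd : ∀ i, (f i).IsHomogeneous d)
    (hf : RegularUpTo f r) (T : Finset (Fin s)) (hT : T.card ≤ r) :
    HasRelativeLinearResolution d d (indexIdeal f T) ⊥ := by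
  induction T using Finset.induction_on with
  | empty => exact hasRelativeLinearResolution_of_le (by simp [indexIdeal])
  | insert j T hj ih =>
    rw [Finset.card_insert_of_notMem hj] at hT
    have h1 := ih (by omega)
    -- The quotient of the new ideal by the old one is `R / (T)` shifted by `d`, since `f j` is
    -- regular modulo `T`.
    have h2 := (hasRelativeLinearResolution_top h1).mul (hd j) (hf T j (by omega) hj)
    rw [add_zero, Ideal.mul_top, ← indexIdeal_insert] at h2
    exact h1.trans (isGradedIdeal_of_isHomogeneous (Ideal.IsHomogeneous.bot _)) bot_le
      (indexIdeal_mono (Finset.subset_insert _ _)) h2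

theorem hasRelativeLinearResolution_foldIdeal (hd : ∀ i, (f i).IsHomogeneous d)
    (hf : RegularUpTo f r) (hs : SpannedBy f r) (N : ℕ) :
    ∀ (T : Finset (Fin s)) (m : Fin s → ℕ) (a : ℕ), T.card ≤ r → ∑ i, m i ≤ N →
      HasRelativeLinearResolution d (d * a) (foldIdeal f m a ⊔ indexIdeal f T)
        (indexIdeal f T) := by
  induction N with
  | zero =>
    intro T m a hT hN
    rcases a with _ | a
    · rw [foldIdeal_zero, top_sup_eq, mul_zero]
      exact hasRelativeLinearResolution_top (hasRelativeLinearResolution_indexIdeal hd hf T hT)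
    · refine hasRelativeLinearResolution_of_le (sup_le ?_ le_rfl)
      refine foldIdeal_le_indexIdeal (fun j _ => ?_) a.succ_pos
      exact (Finset.sum_eq_zero_iff.1 (Nat.le_zero.1 hN)) j (Finset.mem_univ j)
  | succ N ih =>
    intro T m a hT hN
    rcases a with _ | a
    · rw [foldIdeal_zero, top_sup_eq, mul_zero]
      exact hasRelativeLinearResolution_top (hasRelativeLinearResolution_indexIdeal hd hf T hT)
    rcases hT.eq_or_lt with hT | hT
    -- With `r` elements, `T` generates all the forms, so the fold ideal vanishes modulo `T`.
    · refine hasRelativeLinearResolution_of_le (sup_le ?_ le_rfl)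
      refine (foldIdeal_le_indexIdeal (A := Finset.univ) (by simp) a.succ_pos).trans ?_
      exact indexIdeal_le_iff.2 fun i _ => hs T hT.ge i
    by_cases hex : ∃ j, j ∉ T ∧ 0 < m j
    · obtain ⟨j, hjT, hj⟩ := hex
      have hN0 := sum_update_zero (m := m) (Finset.mem_univ j)
      have hN1 := sum_update_pred hj (Finset.mem_univ j)
      have hreg : ∀ g, f j * g ∈ indexIdeal f T → g ∈ indexIdeal f T := hf T j hT hjT
      have hTj : indexIdeal f T ≤ indexIdeal f (insert j T) :=
        indexIdeal_mono (Finset.subset_insert _ _)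
      have hgT := isGradedIdeal_of_isHomogeneous (isHomogeneous_indexIdeal hd T)
      have h1 := (ih T (Function.update m j (m j - 1)) a hT.le (by omega)).mul (hd j) hreg
      have h2 := ih (insert j T) (Function.update m j 0) (a + 1)
        (by rw [Finset.card_insert_of_notMem hjT]; omega) (by omega)
      have e1 : foldIdeal f (Function.update m j 0) (a + 1) ⊔ indexIdeal f (insert j T) =
          (foldIdeal f m (a + 1) ⊔ indexIdeal f T) ⊔ indexIdeal f (insert j T) := by
        rw [sup_assoc, sup_eq_right.2 hTj]
        refine le_antisymm (sup_le_sup (foldIdeal_mono fun i => ?_) le_rfl)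
          (sup_le ((foldIdeal_le_sup f m _ j).trans (sup_le_sup le_rfl ?_)) le_sup_right)
        · rcases eq_or_ne i j with rfl | hij <;> simp [*]
        · rw [Ideal.span_singleton_le_iff_mem]
          exact mem_indexIdeal (Finset.mem_insert_self _ _)
      -- The kernel of reduction modulo `f j`: by the colon formula modulo `T`, it is `f j` times
      -- the fold ideal for `(m - e_j, a)`.
      have e2 : (foldIdeal f m (a + 1) ⊔ indexIdeal f T) ⊓ indexIdeal f (insert j T) =
          Ideal.span {f j} * (foldIdeal f (Function.update m j (m j - 1)) a ⊔ indexIdeal f T) ⊔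
            indexIdeal f T := by
        refine le_antisymm ?_ (sup_le ?_ (le_inf le_sup_right hTj))
        · rintro x ⟨hx1, hx2⟩
          rw [SetLike.mem_coe, indexIdeal_insert] at hx2
          obtain ⟨y, hy, t, ht, rfl⟩ := Submodule.mem_sup.1 hx2
          obtain ⟨u, rfl⟩ := Ideal.mem_span_singleton.1 hy
          have h3 : f j * u ∈ foldIdeal f m (a + 1) ⊔ indexIdeal f T :=
            (Submodule.add_mem_iff_left _ (Ideal.mem_sup_right ht)).1 hx1
          rw [mul_mem_foldIdeal_sup_iff hf hs hj hjT hT] at h3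
          exact Submodule.add_mem_sup
            (Ideal.mul_mem_mul (Ideal.mem_span_singleton_self _) h3) ht
        · intro x hx
          obtain ⟨u, hu, rfl⟩ := Ideal.mem_span_singleton_mul.1 hx
          exact ⟨(mul_mem_foldIdeal_sup_iff hf hs hj hjT hT).2 hu,
            Ideal.mul_mem_right _ _ (mem_indexIdeal (Finset.mem_insert_self _ _))⟩
      rw [e1] at h2
      have h3 := h2.inf_right
        ((isGradedIdeal_of_isHomogeneous (isHomogeneous_foldIdeal hd)).sup hgT)
        (isGradedIdeal_of_isHomogeneous (isHomogeneous_indexIdeal hd _))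
      rw [e2] at h3
      rw [show d + d * a = d * (a + 1) by ring] at h1
      exact h1.trans hgT le_sup_right (e2 ▸ inf_le_left) h3
    · push Not at hex
      refine hasRelativeLinearResolution_of_le (sup_le ?_ le_rfl)
      exact foldIdeal_le_indexIdeal (fun j hj => by simpa using hex j hj) a.succ_pos

end Fold

/-! ### Regularity and spanning from strong genericity. -/

section Generic

variable {K : Type*} [Field K] {σ : Type*} {s c : ℕ} {f : Fin s → MvPolynomial σ K}

lemma ofList_map_toList (f : Fin s → MvPolynomial σ K) (A : Finset (Fin s)) :
    Ideal.ofList (A.toList.map f) = indexIdeal f A := by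
  rw [Ideal.ofList, indexIdeal]
  congr 1
  ext x
  simp

lemma IsGeneric.regularUpTo (hf : IsGeneric f c) : RegularUpTo f (c + 1) := by
  intro A j hA hj h hh
  have h1 := (hf.2 (A.toList ++ [j]) (by simpa [List.nodup_append, A.nodup_toList] using hj)
    (by simpa using hA)).toIsWeaklyRegular
  rw [List.map_append, RingTheory.Sequence.isWeaklyRegular_append_iff] at h1
  have h2 := h1.2
  rw [List.map_singleton, RingTheory.Sequence.isWeaklyRegular_singleton_iff, ofList_map_toList,
    smul_eq_mul, Ideal.mul_top] at h2
  have h3 : f j • (Submodule.Quotient.mk h : MvPolynomial σ K ⧸ indexIdeal f A) = 0 := by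
    rw [← Submodule.Quotient.mk_smul, Submodule.Quotient.mk_eq_zero]
    exact hh
  exact (Submodule.Quotient.mk_eq_zero _).1 (h2.right_eq_zero_of_smul h3)

lemma IsGeneric.indexIdeal_ne_top (hf : IsGeneric f c) {A : Finset (Fin s)}
    (hA : A.card ≤ c + 1) : indexIdeal f A ≠ ⊤ := by
  have h1 := (hf.2 A.toList A.nodup_toList (by simpa using hA)).top_ne_smul
  rw [ofList_map_toList, smul_eq_mul, Ideal.mul_top] at h1
  exact h1.symm

lemma span_le_indexIdeal (f : Fin s → MvPolynomial σ K) (A : Finset (Fin s)) :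
    Submodule.span K (f '' (A : Set (Fin s))) ≤ (indexIdeal f A).restrictScalars K :=
  Submodule.span_le.2 Ideal.subset_span

/-- A form in the linear span of the others lies in their ideal; being regular modulo that ideal, it
would put `1` there. -/
lemma IsGeneric.linearIndepOn (hf : IsGeneric f c) {A : Finset (Fin s)} (hA : A.card ≤ c + 1) :
    LinearIndepOn K f (A : Set (Fin s)) := by
  rw [linearIndepOn_iff_notMem_span]
  intro j hj hmem
  have hlt : (A.erase j).card < c + 1 := (Finset.card_erase_lt_of_mem hj).trans_le hA
  rw [← Finset.coe_erase] at hmem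
  have h1 : f j * 1 ∈ indexIdeal f (A.erase j) := by
    rw [mul_one]
    exact span_le_indexIdeal f _ hmem
  have h2 := hf.regularUpTo _ j hlt (Finset.notMem_erase _ _) 1 h1
  exact hf.indexIdeal_ne_top hlt.le ((Ideal.eq_top_iff_one _).2 h2)

/-- Any `c + 1` of the forms are linearly independent, hence a basis of the span of all. -/
lemma IsGeneric.spannedBy (hf : IsGeneric f c)
    (hr : Module.finrank K (Submodule.span K (Set.range f)) = c + 1) : SpannedBy f (c + 1) := by
  intro B hB i
  obtain ⟨A, hAB, hA⟩ := Finset.exists_subset_card_eq hB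
  have hle : Submodule.span K (f '' (A : Set (Fin s))) ≤ Submodule.span K (Set.range f) :=
    Submodule.span_mono (Set.image_subset_range _ _)
  have hfin : FiniteDimensional K (Submodule.span K (Set.range f)) :=
    FiniteDimensional.span_of_finite K (Set.finite_range f)
  have h1 := Submodule.eq_of_le_of_finrank_eq hle (by
    rw [hr, Set.image_eq_range]
    refine (finrank_span_eq_card (hf.linearIndepOn hA.le)).trans ?_
    simpa using hA)
  have h2 : f i ∈ Submodule.span K (f '' (A : Set (Fin s))) :=
    h1 ▸ Submodule.subset_span ⟨i, rfl⟩
  exact indexIdeal_mono hAB (span_le_indexIdeal f A h2)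

lemma IsGeneric.ne_zero (hf : IsGeneric f c) (i : Fin s) : f i ≠ 0 := by
  intro h0
  have := hf.regularUpTo ∅ i (by simp) (by simp) 1 (by simp [h0])
  exact hf.indexIdeal_ne_top (by simp) ((Ideal.eq_top_iff_one _).2 this)

lemma IsGeneric.pos_of_isHomogeneous (hf : IsGeneric f c) {i : Fin s} {d : ℕ}
    (hd : (f i).IsHomogeneous d) : 0 < d := by
  rcases Nat.eq_zero_or_pos d with rfl | h
  · exfalso
    have h1 : f i = C (coeff 0 (f i)) :=
      totalDegree_eq_zero_iff_eq_C.1 (Nat.le_zero.1 hd.totalDegree_le)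
    have h2 : IsUnit (f i) := by
      rw [h1]
      refine (Ne.isUnit fun h => hf.ne_zero i ?_).map C
      rw [h1, h, map_zero]
    exact hf.indexIdeal_ne_top (A := {i}) (by simp)
      (Ideal.eq_top_of_isUnit_mem _ (mem_indexIdeal (Finset.mem_singleton_self i)) h2)
  · exact h

end Generic

end FoldProduct

theorem mainTheorem12 {K : Type*} [Field K] (n s : ℕ)
    (f : Fin s → MvPolynomial (Fin (n + 1)) K) (hf : FoldProduct.IsStronglyGeneric f)
    (m : Fin s → ℕ) (hm : ∀ i, 0 < m i) (a : ℕ) (ha : 0 < a) (ham : a ≤ ∑ i, m i) :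
    (FoldProduct.foldIdeal f m a =
        ⨅ c ∈ Finset.Icc 1 s, ⨅ A ∈ Finset.powersetCard c (Finset.univ : Finset (Fin s)),
          Ideal.span (f '' (A : Set (Fin s))) ^ FoldProduct.mu m a A) ∧
      (∀ k : Fin s,
        (FoldProduct.foldIdeal f (Function.update m k (m k + 1)) (a + 1)).colon {f k} =
          FoldProduct.foldIdeal f m a) ∧
      FoldProduct.HasKoszulStrandedBettiTable (FoldProduct.foldIdeal f m a) := by
  obtain ⟨⟨d, hd⟩, hg, hr⟩ := hf
  have hreg := hg.regularUpTo
  have hs := hg.spannedBy hr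
  refine ⟨FoldProduct.foldIdeal_eq_iInf hreg hs ham,
    FoldProduct.foldIdeal_colon hreg hs n.succ_pos, ?_⟩
  obtain ⟨e, he, hea⟩ := FoldProduct.exists_le_sum_eq m ham
  -- Positivity of `d` needs an actual form: for an empty family the common degree is arbitrary.
  obtain ⟨i, -, -⟩ : ∃ i ∈ Finset.univ, e i ≠ 0 :=
    Finset.exists_ne_zero_of_sum_ne_zero (hea.trans_ne ha.ne')
  have hd0 : 0 < d := hg.pos_of_isHomogeneous (hd i)
  have h := FoldProduct.hasRelativeLinearResolution_foldIdeal hd hreg hs _ ∅ m a (by simp) le_rfl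
  have h0 : FoldProduct.indexIdeal f ∅ = ⊥ := by simp [FoldProduct.indexIdeal]
  rw [h0, sup_bot_eq] at h
  refine h.hasKoszulStrandedBettiTable hd0 (Nat.mul_pos hd0 ha)
    (FoldProduct.isHomogeneous_foldIdeal hd) (FoldProduct.foldIdeal_le_maxIdeal_pow hd)
    (g := ∏ i, f i ^ e i) (Ideal.subset_span ⟨e, he, hea, rfl⟩)
    (hea ▸ FoldProduct.isHomogeneous_prod_pow hd e)
    (Finset.prod_ne_zero_iff.2 fun i _ => pow_ne_zero _ (hg.ne_zero i))
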